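/- For a group \(G\) and \(\varphi\in\mathrm{Aut}(G)\), let \(R(\varphi)\in\mathbb{N}\cup\{\infty\}\) be the number of classes of the equivalence relation \(u\sim v \iff u=gv\varphi(g)^{-1}\) for some \(g\in G\), and let \(\mathrm{Spec}_R(G)=\{R(\varphi)\mid\varphi\in\mathrm{Aut}(G)\}\). For positive integers \(a,b\) put \[ D(a,b)=\{(d_0,\dots,d_{b-1})\in\mathbb{Z}_{\ge 0}^{b}\mid d_i\mid a \text{ for all } i,\ \gcd(d_i,d_j)=1\text{ for all } i\neq j\}, \] \[ D'(a,b)=\{(d_0,\dots,d_{b-1})\in D(a,b)\mid d_i\equiv 0 \bmod 3 \text{ for some } i\}. \] **Theorem.** Let \(p\) be a prime, let \(n\ge 2\) be an integer coprime to \(p\), and let \(m\ge 1\), with \(m\ge 3\) if \(p=2\). Let \(G=(C_n\times C_{p^m})\rtimes_\alpha C_p\), where \(C_k\) denotes a cyclic group of order \(k\) and \(\alpha:C_p\to\mathrm{Aut}(C_n\times C_{p^m})\) is a homomorphism such that \(C_p\) acts freely on \(C_n\) (that is, for \(1\ne c\in C_p\), \(\alpha(c)\) fixes no non-trivial element of \(C_n\)).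 Let \(y\) be a generator of \(C_p\), and suppose that \(\alpha(y)\) is the map \(g\mapsto g^{a}\) with \(a\equiv\beta p^{m-1}+1 \bmod p^m\) for some \(\beta\in\{1,\dots,p-1\}\) (so \(C_p\) acts non-trivially on \(C_{p^m}\)). Then \(m\ge 2\), all Reidemeister numbers \(R(\varphi)\), \(\varphi\in\mathrm{Aut}(G)\), are finite, and: 1. If \(p\) is odd, then \[ \mathrm{Spec}_R(G)=\Bigl\{p^{e+1}+p^{e}\sum_{i=0}^{p-1}\frac{d_i-1}{p}\ \Bigm|\ 0\le e\le m-1,\ (d_0,\dots,d_{p-1})\in D(np,p),\ \bigl(p\mid d_0\cdots d_{p-1}\iff e=m-1\bigr)\Bigr\}. \] 2. If \(p=2\) and \(3\nmid n\), then \[ \mathrm{Spec}_R(G)=\Bigl\{2^{e+1}+2^{e}\cdot\frac{d_0+d_1-2}{2}\ \Bigm|\ 1\le e\le m-1,\ (d_0,d_1)\in D(2n,2),\ \bigl(2\mid d_0d_1\iff e=m-1\bigr)\Bigr\}. \] 3. If \(p=2\) and \(3\mid n\), then the formula in 2 holds with \(D(2n,2)\) replaced by \(D'(2n,2)\). -/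

import Mathlib

/-- The `φ`-conjugacy relation on a group: `x ∼ y` iff `x = g * y * φ(g)⁻¹` for some `g`. -/
def twistedConj {G : Type*} [Group G] (φ : MulAut G) : Setoid G where
  r x y := ∃ g : G, x = g * y * (φ g)⁻¹
  iseqv :=
    { refl := fun x => ⟨1, by simp⟩
      symm := by
        rintro x y ⟨g, rfl⟩
        exact ⟨g⁻¹, by simp [mul_assoc]⟩
      trans := by
        rintro x y z ⟨g, rfl⟩ ⟨h, rfl⟩
        exact ⟨g * h, by simp [mul_assoc]⟩ }

/-- The Reidemeister number `R(φ)`: the number of `φ`-conjugacy classes, possibly infinite. -/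
noncomputable def reidemeisterNumber {G : Type*} [Group G] (φ : MulAut G) : ℕ∞ :=
  ENat.card (Quotient (twistedConj φ))

/-- The Reidemeister spectrum of a group. -/
def reidemeisterSpectrum (G : Type*) [Group G] : Set ℕ∞ :=
  {r | ∃ φ : MulAut G, r = reidemeisterNumber φ}

/-- The data `(A, B, C, α)` presents the semi-direct product `(A × B) ⋊[α] C` as an
`SMC(n, m, p)`: `A`, `B`, `C` are cyclic of orders `n`, `p ^ m`, `p`, where `p` is a prime not
dividing `n ≥ 1`, and `C` acts freely by automorphisms on `A`. -/
structure IsSMC (n m p : ℕ) {A B C : Type*} [Group A] [Group B] [Group C]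
    (α : C →* MulAut (A × B)) : Prop where
  n_pos : 1 ≤ n
  prime : p.Prime
  coprime : n.Coprime p
  cyclic_A : IsCyclic A
  cyclic_B : IsCyclic B
  cyclic_C : IsCyclic C
  card_A : Nat.card A = n
  card_B : Nat.card B = p ^ m
  card_C : Nat.card C = p
  free : ∀ c : C, c ≠ 1 → ∀ g : A, α c (g, 1) = (g, 1) → g = 1

/-- `D(a, b)`: the `b`-tuples of pairwise coprime divisors of `a`. -/
def divisorTuples (a b : ℕ) : Set (Fin b → ℕ) :=
  {d | (∀ i, d i ∣ a) ∧ ∀ i j, i ≠ j → (d i).Coprime (d j)}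

/-- `D'(a, b)`: the tuples in `D(a, b)` having an entry divisible by `3`. -/
def divisorTuplesThree (a b : ℕ) : Set (Fin b → ℕ) :=
  {d | d ∈ divisorTuples a b ∧ ∃ i, 3 ∣ d i}

/-- The rational numbers `p ^ (e + 1) + p ^ e * ∑ i, (d i - 1) / p`, where `l ≤ e ≤ m - 1`, the
tuple `d` lies in `D`, and `p` divides `∏ i, d i` exactly when `e = m - 1`. -/
def candidateSet (m p l : ℕ) (D : Set (Fin p → ℕ)) : Set ℚ :=
  {q | ∃ e : ℕ, ∃ d ∈ D, l ≤ e ∧ e ≤ m - 1 ∧ (p ∣ ∏ i, d i ↔ e = m - 1) ∧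
    q = (p : ℚ) ^ (e + 1) + (p : ℚ) ^ e * ∑ i, ((d i : ℚ) - 1) / (p : ℚ)}

/-! Let N = C_n × C_{p^m}, cyclic of order np^m. No non-trivial n-torsion element of N is fixed by a
non-trivial element of C_p. This rigidity forces every automorphism φ to preserve N, to act on it by
u ↦ u^s with s prime to np^m, and to induce the identity on C_p; the relation y^p = 1 then gives
φ(c) = z^(p^(m-1)) c (`exists_forall_mulAut_apply_eq`).

Burnside's lemma reduces R(φ) to counting pairs with g x φ(g)⁻¹ = x. For components y^k of g and y^i
of x this is an equation u^(1 - s a^i) v^(a^k - 1) = w in N. It is soluble because w is a p^(m-1)-th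
power, trivial for k = 0, so it has |N| gcd(1 - s a^i, a^k - 1, |N|) solutions. As gcd(a^k - 1, |N|)
= p^(m-1) for 0 < k < p, this yields p R(φ) = ∑_i (gcd(1 - s a^i, np^m) + (p - 1) p^e) with p^e =
gcd(1 - s, p^(m-1)) (`card_quotient_mul`).

The gcds have the form p^e d_i with d in D(np, p) (`exists_tuple`). Conversely, the Chinese
remainder theorem builds s from e and d (`exists_unit_of_tuple`). A prime q ∣ n dividing no d_i
requires s mod q to avoid 0 and the p residues a^(-i). This is possible because q ≡ 1 mod p gives q
> p + 1, except for p = 2, q = 3: hence D'. For p = 2 the unit s is odd, hence e ≥ 1. -/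

/-- `a` acts on `ℤ / n * p ^ m` as a generator of `C_p`: it has order `p`, it is `1 + β * p ^ (m - 1)`
modulo `p ^ m`, and its powers act without fixed points modulo `n`. -/
structure IsModularExponent (n m p a β : ℕ) : Prop where
  n_pos : 0 < n
  prime : p.Prime
  coprime : n.Coprime p
  two_le : 2 ≤ m
  three_le : p = 2 → 3 ≤ m
  beta_pos : 0 < β
  beta_lt : β < p
  modEq : (p : ℤ) ^ m ∣ (a : ℤ) - (β * p ^ (m - 1) + 1)
  pow_eq : ((n * p ^ m : ℕ) : ℤ) ∣ (a : ℤ) ^ p - 1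
  free : ∀ q : ℕ, q.Prime → q ∣ n → ∀ k, 0 < k → k < p → ¬ (q : ℤ) ∣ (a : ℤ) ^ k - 1

/-! ### Powers of `a` modulo `p ^ m` and modulo `n`. -/

namespace IsModularExponent

variable {n m p a β : ℕ} (h : IsModularExponent n m p a β)
include h

/-- Terms quadratic in `p ^ (m - 1)` vanish modulo `p ^ m` since 2(m - 1) ≥ m. -/
theorem pow_sub_one_modEq (k : ℕ) :
    (p : ℤ) ^ m ∣ (a : ℤ) ^ k - (k * β * p ^ (m - 1) + 1) := by
  have h2 : (p : ℤ) ^ m ∣ (p : ℤ) ^ (m - 1) * p ^ (m - 1) := by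
    rw [← pow_add]; exact pow_dvd_pow _ (by have := h.two_le; omega)
  induction k with
  | zero => simp
  | succ k ih =>
    have e : (a : ℤ) ^ (k + 1) - ((k + 1 : ℕ) * β * p ^ (m - 1) + 1) =
        ((a : ℤ) ^ k - (k * β * p ^ (m - 1) + 1)) * a +
        (k * β * p ^ (m - 1) + 1) * ((a : ℤ) - (β * p ^ (m - 1) + 1)) +
        (p : ℤ) ^ (m - 1) * p ^ (m - 1) * (k * β * β) := by push_cast; ring
    rw [e]
    exact dvd_add (dvd_add (ih.mul_right _) (h.modEq.mul_left _)) (h2.mul_right _)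

theorem dvd_pow_sub_one (k : ℕ) : (p : ℤ) ^ (m - 1) ∣ (a : ℤ) ^ k - 1 := by
  have h1 := (pow_dvd_pow (p : ℤ) (Nat.sub_le m 1)).trans (h.pow_sub_one_modEq k)
  have h2 : (p : ℤ) ^ (m - 1) ∣ k * β * p ^ (m - 1) := Dvd.intro_left _ rfl
  rw [show (a : ℤ) ^ k - 1 = (a : ℤ) ^ k - (k * β * p ^ (m - 1) + 1) + k * β * p ^ (m - 1) by ring]
  exact dvd_add h1 h2

theorem pow_eq_mul : (p : ℤ) ^ m = p ^ (m - 1) * p := by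
  rw [← pow_succ]; congr 1; have := h.two_le; omega

theorem not_dvd_pow_sub_one {k : ℕ} (hk : 0 < k) (hkp : k < p) :
    ¬ (p : ℤ) ^ m ∣ (a : ℤ) ^ k - 1 := by
  intro hd
  have h1 := dvd_sub hd (h.pow_sub_one_modEq k)
  have e : (a : ℤ) ^ k - 1 - ((a : ℤ) ^ k - (k * β * p ^ (m - 1) + 1)) =
    p ^ (m - 1) * (k * β) := by ring
  rw [e, h.pow_eq_mul] at h1
  have h2 := Int.dvd_of_mul_dvd_mul_left (by have := h.prime.pos; positivity) h1
  have h3 : p ∣ k * β := by exact_mod_cast h2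
  rcases h.prime.dvd_mul.1 h3 with h4 | h4
  · exact absurd (Nat.le_of_dvd hk h4) (by omega)
  · exact absurd (Nat.le_of_dvd h.beta_pos h4) (by have := h.beta_lt; omega)

/-- The geometric sum is p modulo p², hence p times a unit modulo p: the correction is β p^(m-1) ∑
k. For odd p the factor ∑ k supplies a p; for p = 2 it equals 1, and 4 ∣ p^(m-1) requires m ≥ 3. -/
theorem dvd_of_dvd_mul_geom_sum {t : ℤ}
    (ht : (p : ℤ) ^ m ∣ t * ∑ k ∈ Finset.range p, (a : ℤ) ^ k) : (p : ℤ) ^ (m - 1) ∣ t := by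
  have hp := h.prime
  have hm := h.two_le
  have hpm : (p : ℤ) ^ 2 ∣ p ^ m := pow_dvd_pow _ hm
  have h1 : (p : ℤ) ^ 2 ∣ ∑ k ∈ Finset.range p, ((a : ℤ) ^ k - (k * β * p ^ (m - 1) + 1)) :=
    Finset.dvd_sum fun k _ => hpm.trans (h.pow_sub_one_modEq k)
  have h2 : (p : ℤ) ^ 2 ∣ (∑ k ∈ Finset.range p, (k : ℤ)) * p ^ (m - 1) := by
    by_cases h2 : p = 2
    · exact (pow_dvd_pow _ (by have := h.three_le h2; omega)).mul_left _
    · rw [sq]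
      refine mul_dvd_mul ?_ (dvd_pow_self _ (by omega))
      have h3 := Finset.sum_range_id_mul_two p
      have h4 : p ∣ (∑ k ∈ Finset.range p, k) * 2 := h3 ▸ Dvd.intro _ rfl
      have h5 := ((Nat.coprime_primes hp Nat.prime_two).2 h2).dvd_of_dvd_mul_right h4
      simpa using Int.natCast_dvd_natCast.2 h5
  have h3 : (p : ℤ) ^ 2 ∣ (∑ k ∈ Finset.range p, (a : ℤ) ^ k) - p := by
    have e : (∑ k ∈ Finset.range p, (a : ℤ) ^ k) - p =
        (∑ k ∈ Finset.range p, ((a : ℤ) ^ k - (k * β * p ^ (m - 1) + 1))) +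
          (∑ k ∈ Finset.range p, (k : ℤ)) * p ^ (m - 1) * β := by
      rw [Finset.sum_sub_distrib, Finset.sum_add_distrib, ← Finset.sum_mul, ← Finset.sum_mul]
      simp
      ring
    rw [e]
    exact dvd_add h1 (h2.mul_right β)
  obtain ⟨c, hc⟩ := h3
  rw [show (∑ k ∈ Finset.range p, (a : ℤ) ^ k) = p * (1 + p * c) by linear_combination hc,
    h.pow_eq_mul, show t * (p * (1 + p * c)) = t * (1 + p * c) * p by ring] at ht
  have h4 := Int.dvd_of_mul_dvd_mul_right (by exact_mod_cast hp.ne_zero) ht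
  exact IsCoprime.dvd_of_dvd_mul_right (IsCoprime.pow_left ⟨-c, 1, by ring⟩) h4

theorem gcd_pow_sub_one_eq_one {k : ℕ} (hk : 0 < k) (hkp : k < p) :
    Int.gcd ((a : ℤ) ^ k - 1) n = 1 := by
  by_contra hne
  obtain ⟨q, hq, hqd⟩ := Nat.exists_prime_and_dvd hne
  have h1 := Int.natCast_dvd_natCast.2 hqd
  exact h.free q hq (by exact_mod_cast h1.trans (Int.gcd_dvd_right _ _)) k hk hkp
    (h1.trans (Int.gcd_dvd_left _ _))

theorem gcd_pow_sub_one {k : ℕ} (hk : 0 < k) (hkp : k < p) :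
    Int.gcd ((a : ℤ) ^ k - 1) (n * p ^ m : ℕ) = p ^ (m - 1) := by
  have h1 := h.gcd_pow_sub_one_eq_one hk hkp
  have hd : Int.gcd ((a : ℤ) ^ k - 1) (n * p ^ m : ℕ) ∣ p ^ m := by
    have hc : Nat.Coprime (Int.gcd ((a : ℤ) ^ k - 1) (n * p ^ m : ℕ)) n := by
      refine Nat.Coprime.coprime_dvd_left (k := ((a : ℤ) ^ k - 1).natAbs) ?_ h1
      exact Nat.gcd_dvd_left _ _
    exact hc.dvd_of_dvd_mul_left (Nat.gcd_dvd_right _ _)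
  obtain ⟨j, hj, hje⟩ := (Nat.dvd_prime_pow h.prime).1 hd
  have hl : Int.gcd ((a : ℤ) ^ k - 1) (n * p ^ m : ℕ) ≠ p ^ m := by
    intro he
    refine h.not_dvd_pow_sub_one hk hkp ?_
    have := Int.gcd_dvd_left ((a : ℤ) ^ k - 1) (n * p ^ m : ℕ)
    rw [he] at this
    exact_mod_cast this
  have hm := h.two_le
  have hjm : j ≤ m - 1 := by
    have : j ≠ m := by rintro rfl; exact hl hje
    omega
  refine Nat.dvd_antisymm (hje ▸ pow_dvd_pow _ hjm) ?_
  refine Int.dvd_gcd ?_ ?_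
  · exact_mod_cast h.dvd_pow_sub_one k
  · exact_mod_cast (pow_dvd_pow p (Nat.sub_le m 1)).mul_left n

omit h in
theorem dvd_pow_sub_one_of_dvd {r s : ℤ} {i j : ℕ} (hij : i ≤ j)
    (hi : r ∣ 1 - s * (a : ℤ) ^ i) (hj : r ∣ 1 - s * (a : ℤ) ^ j) : r ∣ (a : ℤ) ^ (j - i) - 1 := by
  have e : (a : ℤ) ^ (j - i) - 1 =
      (1 - s * (a : ℤ) ^ i) * a ^ (j - i) - (1 - s * (a : ℤ) ^ j) := by
    have : (a : ℤ) ^ j = a ^ i * a ^ (j - i) := by rw [← pow_add]; congr 1; omega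
    rw [this]; ring
  rw [e]
  exact dvd_sub (hi.mul_right _) hj

omit h in
-- Used with r a prime of n and with r = p^m, this is the source of the pairwise coprimality of the
-- tuples.
theorem index_unique_of_free {r s : ℤ} (hr : ∀ k, 0 < k → k < p → ¬ r ∣ (a : ℤ) ^ k - 1) {i j : ℕ}
    (hi : i < p) (hj : j < p) (h1 : r ∣ 1 - s * (a : ℤ) ^ i) (h2 : r ∣ 1 - s * (a : ℤ) ^ j) :
    i = j := by
  by_contra hne
  rcases Nat.lt_or_gt_of_ne hne with hl | hl
  · exact hr (j - i) (by omega) (by omega) (dvd_pow_sub_one_of_dvd hl.le h1 h2)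
  · exact hr (i - j) (by omega) (by omega) (dvd_pow_sub_one_of_dvd hl.le h2 h1)

theorem index_unique {s : ℤ} {i j : ℕ} (hi : i < p)
    (hj : j < p) (h1 : (p : ℤ) ^ m ∣ 1 - s * (a : ℤ) ^ i)
    (h2 : (p : ℤ) ^ m ∣ 1 - s * (a : ℤ) ^ j) : i = j :=
  index_unique_of_free (fun _ => h.not_dvd_pow_sub_one) hi hj h1 h2

/-- The p powers of `a` exhaust the residues modulo p^m that are 1 modulo p^(m-1), so one of them is
inverse to s. -/
theorem exists_index {s : ℤ} (hs : (p : ℤ) ^ (m - 1) ∣ 1 - s) :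
    ∃ i < p, (p : ℤ) ^ m ∣ 1 - s * (a : ℤ) ^ i := by
  have hp := h.prime
  have hm := h.two_le
  have : Fact p.Prime := ⟨hp⟩
  obtain ⟨w, hw⟩ := hs
  have hβ : (β : ZMod p) ≠ 0 := by
    rw [Ne, ZMod.natCast_eq_zero_iff]
    exact fun hd => absurd (Nat.le_of_dvd h.beta_pos hd) (by have := h.beta_lt; omega)
  have hs : (s : ZMod p) ≠ 0 := by
    have : (s : ZMod p) = 1 := by
      have e : s = 1 - p ^ (m - 1) * w := by linarith
      rw [e]
      push_cast
      rw [ZMod.natCast_self, zero_pow (by omega)]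
      ring
    rw [this]; exact one_ne_zero
  -- Modulo p^m, 1 - s a^i is p^(m-1) (w - s i β), so i must solve s i β ≡ w mod p.
  refine ⟨((w : ZMod p) / (s * β)).val, ZMod.val_lt _, ?_⟩
  set i := ((w : ZMod p) / (s * β)).val with hi
  have h1 : (p : ℤ) ∣ w - s * (i * β) := by
    rw [← ZMod.intCast_zmod_eq_zero_iff_dvd]
    push_cast
    rw [hi, ZMod.natCast_zmod_val]
    field_simp
    ring
  have e : 1 - s * (a : ℤ) ^ i = p ^ (m - 1) * (w - s * (i * β)) -
      s * ((a : ℤ) ^ i - (i * β * p ^ (m - 1) + 1)) := by linear_combination hw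
  rw [e]
  refine dvd_sub ?_ ((h.pow_sub_one_modEq i).mul_left _)
  rw [h.pow_eq_mul]
  exact mul_dvd_mul_left _ h1

theorem dvd_one_sub_iff (s : ℤ) (i j : ℕ) (hj : j ≤ m - 1) :
    (p : ℤ) ^ j ∣ 1 - s * (a : ℤ) ^ i ↔ (p : ℤ) ^ j ∣ 1 - s := by
  have h1 := ((pow_dvd_pow (p : ℤ) hj).trans (h.dvd_pow_sub_one i)).mul_left s
  rw [show 1 - s = (1 - s * (a : ℤ) ^ i) + s * ((a : ℤ) ^ i - 1) by ring]
  exact (dvd_add_left h1).symm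

theorem gcd_one_sub (s : ℤ) (i : ℕ) :
    Int.gcd (1 - s * (a : ℤ) ^ i) (p ^ (m - 1) : ℕ) = Int.gcd (1 - s) (p ^ (m - 1) : ℕ) := by
  have key : ∀ x y : ℤ, (∀ j ≤ m - 1, (p : ℤ) ^ j ∣ x → (p : ℤ) ^ j ∣ y) →
      Int.gcd x (p ^ (m - 1) : ℕ) ∣ Int.gcd y (p ^ (m - 1) : ℕ) := by
    intro x y hxy
    have hr : Int.gcd x (p ^ (m - 1) : ℕ) ∣ p ^ (m - 1) := Nat.gcd_dvd_right _ _
    obtain ⟨j, hj, hje⟩ := (Nat.dvd_prime_pow h.prime).1 hr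
    refine Int.dvd_gcd ?_ (by exact_mod_cast hr)
    have := Int.gcd_dvd_left x (p ^ (m - 1) : ℕ)
    rw [hje] at this ⊢
    push_cast at this ⊢
    exact hxy j hj this
  exact Nat.dvd_antisymm (key _ _ fun j hj => (h.dvd_one_sub_iff s i j hj).1)
    (key _ _ fun j hj => (h.dvd_one_sub_iff s i j hj).2)

/-- The ratio of the `p`-parts of `1 - s * a ^ i` modulo `p ^ m` and modulo `p ^ (m - 1)`. -/
theorem gcd_one_sub_prime_pow (s : ℤ) (i : ℕ) :
    Int.gcd (1 - s * (a : ℤ) ^ i) (p ^ m : ℕ) = Int.gcd (1 - s) (p ^ (m - 1) : ℕ) *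
      (if (p : ℤ) ^ m ∣ 1 - s * (a : ℤ) ^ i then p else 1) := by
  have hp := h.prime
  have hm := h.two_le
  rw [← h.gcd_one_sub s i]
  set z := 1 - s * (a : ℤ) ^ i
  split_ifs with hz
  · have hz' := (pow_dvd_pow (p : ℤ) (Nat.sub_le m 1)).trans hz
    have key : ∀ j, (p : ℤ) ^ j ∣ z → Int.gcd z (p ^ j : ℕ) = p ^ j := fun j hj =>
      Nat.gcd_eq_right (Int.natCast_dvd.1 (by exact_mod_cast hj))
    rw [key m hz, key (m - 1) hz', ← pow_succ]
    congr 1; omega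
  · rw [mul_one]
    have hr : Int.gcd z (p ^ m : ℕ) ∣ p ^ m := Nat.gcd_dvd_right _ _
    obtain ⟨j, hj, hje⟩ := (Nat.dvd_prime_pow hp).1 hr
    have hl := Int.gcd_dvd_left z (p ^ m : ℕ)
    have hjm : j ≠ m := by
      rintro rfl
      rw [hje] at hl
      exact hz (by exact_mod_cast hl)
    refine Nat.dvd_antisymm (Int.dvd_gcd hl ?_) ?_
    · rw [hje]
      exact_mod_cast pow_dvd_pow p (by omega)
    · exact Nat.gcd_dvd_gcd_of_dvd_right _ (by
        simpa using pow_dvd_pow p (Nat.sub_le m 1))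

/-- The second factor on the right is the entry of the divisor tuple attached to `s`. -/
theorem gcd_one_sub_mul (s : ℤ) (i : ℕ) :
    Int.gcd (1 - s * (a : ℤ) ^ i) (n * p ^ m : ℕ) = Int.gcd (1 - s) (p ^ (m - 1) : ℕ) *
      (Int.gcd (1 - s * (a : ℤ) ^ i) n *
        (if (p : ℤ) ^ m ∣ 1 - s * (a : ℤ) ^ i then p else 1)) := by
  have h1 : Int.gcd (1 - s * (a : ℤ) ^ i) (n * p ^ m : ℕ) =
      Int.gcd (1 - s * (a : ℤ) ^ i) n * Int.gcd (1 - s * (a : ℤ) ^ i) (p ^ m : ℕ) :=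
    Nat.Coprime.gcd_mul _ (h.coprime.pow_right m)
  rw [h1, h.gcd_one_sub_prime_pow]
  ring

end IsModularExponent

/-! ### Units with prescribed gcds, by the Chinese remainder theorem. -/

theorem Int.gcd_eq_of_dvd_sub {x y : ℤ} {N : ℕ} (hxy : (N : ℤ) ∣ x - y) :
    Int.gcd x N = Int.gcd y N := by
  have key : ∀ x y : ℤ, (N : ℤ) ∣ x - y → Int.gcd x N ∣ Int.gcd y N := fun x y hxy => by
    refine Int.dvd_gcd ?_ (Int.gcd_dvd_right _ _)
    have h1 := dvd_sub (Int.gcd_dvd_left x N) ((Int.gcd_dvd_right x N).trans hxy)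
    rwa [sub_sub_cancel] at h1
  exact Nat.dvd_antisymm (key x y hxy) (key y x (by rw [← neg_sub]; exact hxy.neg_right))

theorem Int.gcd_prime_pow_eq_one {q : ℕ} (hq : q.Prime) {z : ℤ} (hz : ¬ (q : ℤ) ∣ z) (k : ℕ) :
    Int.gcd z (q ^ k : ℕ) = 1 :=
  Nat.Coprime.pow_right k
    ((hq.coprime_iff_not_dvd.2 fun hd => hz (Int.natCast_dvd.2 hd)).symm)

theorem Int.exists_dvd_sub_of_coprime {b c : ℕ} (hbc : b.Coprime c) (x y : ℤ) :
    ∃ s : ℤ, (b : ℤ) ∣ s - x ∧ (c : ℤ) ∣ s - y := by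
  obtain ⟨u, v, huv⟩ := Nat.isCoprime_iff_coprime.2 hbc
  exact ⟨x * (v * c) + y * (u * b), ⟨u * (y - x), by linear_combination x * huv⟩,
    ⟨v * (x - y), by linear_combination y * huv⟩⟩

theorem Int.gcd_mul_of_coprime (z : ℤ) {b c : ℕ} (hbc : b.Coprime c) :
    Int.gcd z (b * c : ℕ) = Int.gcd z b * Int.gcd z c :=
  Nat.Coprime.gcd_mul _ hbc

/-- A unit modulo `n` with prescribed greatest common divisors `gcd (1 - s * a ^ i, n)`. -/
theorem exists_unit_gcd (p a n : ℕ) (hp : 0 < p) (hn : 0 < n) (han : (n : ℤ) ∣ (a : ℤ) ^ p - 1)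
    (hfree : ∀ q : ℕ, q.Prime → q ∣ n → ∀ k, 0 < k → k < p → ¬ (q : ℤ) ∣ (a : ℤ) ^ k - 1)
    (d : Fin p → ℕ) (hd : ∀ i, d i ∣ n) (hcop : ∀ i j, i ≠ j → (d i).Coprime (d j))
    (hbig : ∀ q : ℕ, q.Prime → q ∣ n → (∀ i, ¬ q ∣ d i) → p + 1 < q) :
    ∃ s : ℤ, Int.gcd s n = 1 ∧ ∀ i : Fin p, Int.gcd (1 - s * (a : ℤ) ^ (i : ℕ)) n = d i := by
  induction n using Nat.recOnPosPrimePosCoprime generalizing d with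
  | zero => omega
  | one => exact ⟨1, by simp, fun i => by simpa using (Nat.dvd_one.1 (hd i)).symm⟩
  | prime_pow q k hq hk =>
    have hqk : q ∣ q ^ k := dvd_pow_self q hk.ne'
    have hqa : (q : ℤ) ∣ (a : ℤ) ^ p - 1 := (Int.natCast_dvd_natCast.2 hqk).trans han
    have hqZ : Prime (q : ℤ) := Nat.prime_iff_prime_int.1 hq
    have hna : ¬ (q : ℤ) ∣ a := fun hqa' => hqZ.not_dvd_one (by
      have := dvd_sub (dvd_pow hqa' hp.ne') hqa
      rwa [sub_sub_cancel] at this)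
    have hone : ∀ i, ¬ q ∣ d i → d i = 1 := fun i hi => by
      obtain ⟨j, -, hj⟩ := (Nat.dvd_prime_pow hq).1 (hd i)
      rcases Nat.eq_zero_or_pos j with rfl | hj0
      · simpa using hj
      · exact absurd (hj ▸ dvd_pow_self q hj0.ne') hi
    by_cases hex : ∃ i, q ∣ d i
    · obtain ⟨i₀, hi₀⟩ := hex
      obtain ⟨j, hjk, hj⟩ := (Nat.dvd_prime_pow hq).1 (hd i₀)
      have hj0 : j ≠ 0 := by
        rintro rfl
        rw [hj, pow_zero, Nat.dvd_one] at hi₀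
        exact hq.ne_one hi₀
      have hqj : (q : ℤ) ∣ (q : ℤ) ^ j := dvd_pow_self _ hj0
      have h0 : (1 - (a : ℤ) ^ (p - i₀) * (1 + q ^ j) * a ^ (i₀ : ℕ)) - -(q : ℤ) ^ j =
          -((a : ℤ) ^ p - 1) * (1 + q ^ j) := by
        have : (a : ℤ) ^ p = a ^ (p - i₀ : ℕ) * a ^ (i₀ : ℕ) := by
          rw [← pow_add]; congr 1; have := i₀.2; omega
        rw [this]; ring
      -- The first factor inverts a^i₀, so 1 - s a^i₀ ≡ -q^j modulo q^k; uniqueness of the index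
      -- keeps q away from the other entries.
      refine ⟨(a : ℤ) ^ (p - i₀) * (1 + q ^ j), Int.gcd_prime_pow_eq_one hq ?_ k, fun i => ?_⟩
      · intro hdv
        rcases hqZ.dvd_or_dvd hdv with h1 | h1
        · exact hna (hqZ.dvd_of_dvd_pow h1)
        · exact hqZ.not_dvd_one ((dvd_add_left hqj).1 h1)
      · by_cases hi : i = i₀
        · subst hi
          rw [Int.gcd_eq_of_dvd_sub (y := -(q : ℤ) ^ j) (by
            rw [h0]; exact (han.neg_right).mul_right _), hj, Int.neg_gcd]
          exact_mod_cast Nat.gcd_eq_left (pow_dvd_pow q hjk)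
        · rw [hone i fun hqi => hq.ne_one (Nat.dvd_one.1
            ((hcop i i₀ hi) ▸ Nat.dvd_gcd hqi hi₀))]
          refine Int.gcd_prime_pow_eq_one hq (fun hdv => hi (Fin.ext ?_)) k
          refine IsModularExponent.index_unique_of_free (hfree q hq hqk) i.2 i₀.2 hdv ?_
          have h1 := dvd_add (hqa.neg_right.mul_right (1 + (q : ℤ) ^ j)) hqj.neg_right
          rwa [← h0, sub_add_cancel] at h1
    · push Not at hex
      have : Fact q.Prime := ⟨hq⟩
      -- The forbidden residues of s are 0 and the inverses of the p powers of `a`: at most p + 1 of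
      -- them.
      have hcard : (insert (0 : ZMod q)
          (Finset.univ.image fun i : Fin p => ((a : ZMod q) ^ (i : ℕ))⁻¹)).card < q := by
        refine lt_of_le_of_lt ?_ (hbig q hq hqk hex)
        refine (Finset.card_insert_le _ _).trans (Nat.succ_le_succ ?_)
        simpa using Finset.card_image_le (s := Finset.univ)
          (f := fun i : Fin p => ((a : ZMod q) ^ (i : ℕ))⁻¹)
      obtain ⟨s, hs⟩ : ∃ s : ZMod q, s ∉ insert (0 : ZMod q)
          (Finset.univ.image fun i : Fin p => ((a : ZMod q) ^ (i : ℕ))⁻¹) := by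
        by_contra! hall
        rw [Finset.eq_univ_iff_forall.2 hall, Finset.card_univ, ZMod.card] at hcard
        exact lt_irrefl _ hcard
      simp only [Finset.mem_insert, Finset.mem_image, Finset.mem_univ, true_and, not_or,
        not_exists] at hs
      refine ⟨s.val, Int.gcd_prime_pow_eq_one hq ?_ k, fun i => ?_⟩
      · rw [← ZMod.intCast_zmod_eq_zero_iff_dvd]
        simpa using hs.1
      · rw [hone i (hex i)]
        refine Int.gcd_prime_pow_eq_one hq ?_ k
        rw [← ZMod.intCast_zmod_eq_zero_iff_dvd]
        push_cast
        rw [ZMod.natCast_zmod_val, sub_eq_zero]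
        exact fun he => hs.2 i (eq_inv_of_mul_eq_one_left he.symm).symm
  | coprime b c hb hc hbc ihb ihc =>
    have hcast : ((b * c : ℕ) : ℤ) = b * c := by push_cast; rfl
    rw [hcast] at han
    obtain ⟨s₁, h1, h1'⟩ := ihb (by omega) ((Dvd.intro _ rfl).trans han)
      (fun q hq hqb => hfree q hq (hqb.mul_right _)) (fun i => (d i).gcd b)
      (fun i => Nat.gcd_dvd_right _ _)
      (fun i j hij => ((hcop i j hij).coprime_dvd_left (Nat.gcd_dvd_left _ _)).coprime_dvd_right
        (Nat.gcd_dvd_left _ _))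
      (fun q hq hqb hqd => hbig q hq (hqb.mul_right _)
        fun i hi => hqd i (Nat.dvd_gcd hi hqb))
    obtain ⟨s₂, h2, h2'⟩ := ihc (by omega) ((Dvd.intro_left _ rfl).trans han)
      (fun q hq hqb => hfree q hq (hqb.mul_left _)) (fun i => (d i).gcd c)
      (fun i => Nat.gcd_dvd_right _ _)
      (fun i j hij => ((hcop i j hij).coprime_dvd_left (Nat.gcd_dvd_left _ _)).coprime_dvd_right
        (Nat.gcd_dvd_left _ _))
      (fun q hq hqb hqd => hbig q hq (hqb.mul_left _)
        fun i hi => hqd i (Nat.dvd_gcd hi hqb))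
    obtain ⟨s, hs1, hs2⟩ := Int.exists_dvd_sub_of_coprime hbc s₁ s₂
    refine ⟨s, ?_, fun i => ?_⟩
    · rw [Int.gcd_mul_of_coprime _ hbc, Int.gcd_eq_of_dvd_sub hs1, Int.gcd_eq_of_dvd_sub hs2,
        h1, h2]
    · have key : ∀ x : ℤ, 1 - s * (a : ℤ) ^ (i : ℕ) - (1 - x * (a : ℤ) ^ (i : ℕ)) =
        -((s - x) * a ^ (i : ℕ)) := fun x => by ring
      rw [Int.gcd_mul_of_coprime _ hbc,
        Int.gcd_eq_of_dvd_sub (y := 1 - s₁ * (a : ℤ) ^ (i : ℕ))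
          (by rw [key]; exact (hs1.mul_right _).neg_right),
        Int.gcd_eq_of_dvd_sub (x := 1 - s * (a : ℤ) ^ (i : ℕ)) (y := 1 - s₂ * (a : ℤ) ^ (i : ℕ))
          (by rw [key]; exact (hs2.mul_right _).neg_right), h1', h2', ← hbc.gcd_mul]
      exact Nat.gcd_eq_left (hd i)

/-! ### Correspondence between units s and pairs (e, d). -/

namespace IsModularExponent

variable {n m p a β : ℕ} (h : IsModularExponent n m p a β)
include h

/-- The order of `a` modulo q is p, so q = cp + 1; c = 1 makes p and p + 1 both prime. -/
theorem lt_of_prime_dvd {q : ℕ} (hq : q.Prime) (hqn : q ∣ n) : p = 2 ∧ q = 3 ∨ p + 1 < q := by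
  have hp := h.prime
  have : Fact q.Prime := ⟨hq⟩
  have hqa : (q : ℤ) ∣ (a : ℤ) ^ p - 1 := by
    refine dvd_trans ?_ h.pow_eq
    exact_mod_cast hqn.mul_right _
  have ho : orderOf (a : ZMod q) = p := by
    have : Fact p.Prime := ⟨hp⟩
    refine orderOf_eq_prime ?_ ?_
    · rw [← ZMod.intCast_zmod_eq_zero_iff_dvd] at hqa
      push_cast at hqa
      exact sub_eq_zero.1 hqa
    · intro ha
      refine h.free q hq hqn 1 one_pos hp.one_lt ?_
      rw [← ZMod.intCast_zmod_eq_zero_iff_dvd]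
      push_cast
      rw [pow_one, ha, sub_self]
  have ha0 : (a : ZMod q) ≠ 0 := by
    intro h0
    rw [h0] at ho
    simp only [orderOf_zero] at ho
    exact hp.ne_zero ho.symm
  have hdvd := ZMod.orderOf_dvd_card_sub_one ha0
  rw [ho] at hdvd
  obtain ⟨c, hc⟩ := hdvd
  have hq2 := hq.two_le
  have hp2 := hp.two_le
  rcases Nat.lt_or_ge c 2 with hc2 | hc2
  · interval_cases c
    · omega
    · rcases hp.eq_two_or_odd with h2 | h2
      · exact Or.inl ⟨h2, by omega⟩
      · rcases hq.eq_two_or_odd with h3 | h3 <;> omega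
  · right
    have := Nat.mul_le_mul_left p hc2
    rw [← hc] at this
    omega

theorem exists_tuple {s : ℤ} (hs : Int.gcd s (n * p ^ m : ℕ) = 1) :
    ∃ e : ℕ, ∃ d ∈ divisorTuples (n * p) p, e ≤ m - 1 ∧ (p ∣ ∏ i, d i ↔ e = m - 1) ∧
      Int.gcd (1 - s) (p ^ (m - 1) : ℕ) = p ^ e ∧
      (∀ i : Fin p, Int.gcd (1 - s * (a : ℤ) ^ (i : ℕ)) (n * p ^ m : ℕ) = p ^ e * d i) ∧
      (p = 2 → 1 ≤ e) ∧ (p = 2 → 3 ∣ n → ∃ i, 3 ∣ d i) := by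
  have hp := h.prime
  have hm := h.two_le
  have hr : Int.gcd (1 - s) (p ^ (m - 1) : ℕ) ∣ p ^ (m - 1) := Nat.gcd_dvd_right _ _
  obtain ⟨e, he, hee⟩ := (Nat.dvd_prime_pow hp).1 hr
  have hdn : ∀ i : ℕ, Int.gcd (1 - s * (a : ℤ) ^ i) n ∣ n := fun i => Nat.gcd_dvd_right _ _
  have hns : ∀ q : ℕ, q.Prime → q ∣ n * p ^ m → ¬ (q : ℤ) ∣ s := fun q hq hqn hqs => by
    have := Int.dvd_gcd hqs (Int.natCast_dvd_natCast.2 hqn)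
    rw [hs] at this
    exact hq.ne_one (Nat.dvd_one.1 this)
  refine ⟨e, fun i => Int.gcd (1 - s * (a : ℤ) ^ (i : ℕ)) n *
    (if (p : ℤ) ^ m ∣ 1 - s * (a : ℤ) ^ (i : ℕ) then p else 1), ⟨fun i => ?_, fun i j hij => ?_⟩,
    he, ?_, hee, fun i => ?_, fun h2 => ?_, fun h2 h3 => ?_⟩
  · refine mul_dvd_mul (hdn i) ?_
    split_ifs <;> simp
  · have hnp : ∀ i j : ℕ, Nat.Coprime (Int.gcd (1 - s * (a : ℤ) ^ i) n)
        (if (p : ℤ) ^ m ∣ 1 - s * (a : ℤ) ^ j then p else 1) := fun i j => by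
      split_ifs
      · exact h.coprime.coprime_dvd_left (hdn i)
      · simp
    refine Nat.Coprime.mul_left (Nat.Coprime.mul_right ?_ (hnp _ _))
      (Nat.Coprime.mul_right (hnp _ _).symm ?_)
    · refine Nat.coprime_of_dvd fun q hq h1 h2 => ?_
      have h1' := Int.natCast_dvd_natCast.2 h1
      have h2' := Int.natCast_dvd_natCast.2 h2
      exact hij (Fin.ext (index_unique_of_free (h.free q hq (h1.trans (hdn i))) i.2 j.2
        (h1'.trans (Int.gcd_dvd_left _ _)) (h2'.trans (Int.gcd_dvd_left _ _))))
    · split_ifs with h1 h2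
      · exact absurd (Fin.ext (h.index_unique i.2 j.2 h1 h2)) hij
      all_goals simp
  · rw [hp.prime.dvd_finsetProd_iff]
    constructor
    · rintro ⟨i, -, hi⟩
      rcases hp.dvd_mul.1 hi with h1 | h1
      · exact absurd (Nat.dvd_gcd (h1.trans (hdn i)) dvd_rfl) (by
          rw [Nat.Coprime.gcd_eq_one h.coprime]; exact hp.one_lt.ne' ∘ Nat.dvd_one.1)
      · split_ifs at h1 with h2
        · have h3 := (h.dvd_one_sub_iff s i (m - 1) le_rfl).1
            ((pow_dvd_pow _ (Nat.sub_le m 1)).trans h2)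
          have h4 : p ^ (m - 1) ∣ p ^ e := by
            rw [← hee]
            exact Int.dvd_gcd (by exact_mod_cast h3) dvd_rfl
          have := (Nat.pow_dvd_pow_iff_le_right hp.one_lt).1 h4
          omega
        · exact absurd (Nat.dvd_one.1 h1) hp.ne_one
    · intro hem
      -- e = m - 1 means s ≡ 1 modulo p^(m-1), so some s a^i is 1 modulo p^m and the factor p occurs
      -- there.
      obtain ⟨i, hi, hi'⟩ := h.exists_index (s := s) (by
        have := Int.gcd_dvd_left (1 - s) (p ^ (m - 1) : ℕ)
        rw [hee, hem] at this
        exact_mod_cast this)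
      exact ⟨⟨i, hi⟩, Finset.mem_univ _, by simp [hi']⟩
  · rw [h.gcd_one_sub_mul, hee]
  · by_contra he0
    have h1 : (2 : ℤ) ∣ 1 - s := by
      have h5 : 2 ∣ p ^ m := by
        rw [h2]
        exact dvd_pow_self 2 (by omega)
      have := hns 2 Nat.prime_two (h5.mul_left n)
      push_cast at this
      omega
    have h4 : 2 ∣ p ^ e := by
      rw [← hee]
      refine Int.dvd_gcd h1 ?_
      rw [h2]
      exact_mod_cast dvd_pow_self 2 (by omega)
    rw [show e = 0 by omega, pow_zero] at h4
    omega
  · have hs3 := hns 3 Nat.prime_three (h3.mul_right _)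
    have ha1 := h.free 3 Nat.prime_three h3 1 one_pos hp.one_lt
    have ha2 : ((3 : ℕ) : ℤ) ∣ (a : ℤ) ^ p - 1 := by
      refine dvd_trans ?_ h.pow_eq
      exact_mod_cast h3.mul_right _
    push_cast at hs3 ha1 ha2
    rw [pow_one] at ha1
    have ha2' : (3 : ℤ) ∣ (a : ℤ) + 1 := by
      rw [h2, show (a : ℤ) ^ 2 - 1 = (a + 1) * (a - 1) by ring] at ha2
      exact (Int.prime_three.dvd_or_dvd ha2).resolve_right ha1
    -- Here a ≡ -1 modulo 3, so s ≡ ±1 is inverse to a^0 or to a^1.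
    rcases (by omega : (3 : ℤ) ∣ 1 - s ∨ (3 : ℤ) ∣ 1 + s) with h4 | h4
    · refine ⟨⟨0, by omega⟩, Dvd.dvd.mul_right ?_ _⟩
      exact Int.dvd_gcd (by simpa using h4) (by exact_mod_cast h3)
    · refine ⟨⟨1, by omega⟩, Dvd.dvd.mul_right ?_ _⟩
      refine Int.dvd_gcd ?_ (by exact_mod_cast h3)
      push_cast
      rw [pow_one, show 1 - s * (a : ℤ) = (1 + s) - s * (a + 1) by ring]
      exact dvd_sub h4 (ha2'.mul_left _)

theorem exists_unit_of_tuple {e : ℕ} (he : e ≤ m - 1) {d : Fin p → ℕ}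
    (hd : d ∈ divisorTuples (n * p) p) (hiff : p ∣ ∏ i, d i ↔ e = m - 1) (he2 : p = 2 → 1 ≤ e)
    (h3 : p = 2 → 3 ∣ n → ∃ i, 3 ∣ d i) :
    ∃ s : ℤ, Int.gcd s (n * p ^ m : ℕ) = 1 ∧ Int.gcd (1 - s) (p ^ (m - 1) : ℕ) = p ^ e ∧
      ∀ i : Fin p, Int.gcd (1 - s * (a : ℤ) ^ (i : ℕ)) (n * p ^ m : ℕ) = p ^ e * d i := by
  have hp := h.prime
  have hm := h.two_le
  have hpZ : Prime (p : ℤ) := Nat.prime_iff_prime_int.1 hp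
  obtain ⟨hdv, hcop⟩ := hd
  have hcast : ((n * p ^ m : ℕ) : ℤ) = n * p ^ m := by push_cast; rfl
  obtain ⟨s₁, h1, h1'⟩ := exists_unit_gcd p a n hp.pos h.n_pos
    ((hcast ▸ Dvd.intro _ rfl : (n : ℤ) ∣ (n * p ^ m : ℕ)).trans h.pow_eq) h.free
    (fun i => (d i).gcd n) (fun i => Nat.gcd_dvd_right _ _)
    (fun i j hij => ((hcop i j hij).coprime_dvd_left (Nat.gcd_dvd_left _ _)).coprime_dvd_right
      (Nat.gcd_dvd_left _ _))
    (fun q hq hqn hqd => (h.lt_of_prime_dvd hq hqn).resolve_left (by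
      rintro ⟨rfl, rfl⟩
      obtain ⟨i, hi⟩ := h3 rfl hqn
      exact hqd i (Nat.dvd_gcd hi hqn)))
  obtain ⟨s₂, h2, h2e, h2'⟩ : ∃ s : ℤ, Int.gcd s (p ^ m : ℕ) = 1 ∧
      Int.gcd (1 - s) (p ^ (m - 1) : ℕ) = p ^ e ∧
      ∀ i : Fin p, (p : ℤ) ^ m ∣ 1 - s * (a : ℤ) ^ (i : ℕ) ↔ p ∣ d i := by
    -- The p-part of s is a^(-i₀) when p divides d_{i₀}, and 1 + p^e when p divides no entry; the
    -- latter is a unit because e = 0 is excluded for p = 2.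
    by_cases hem : e = m - 1
    · obtain ⟨i₀, -, hi₀⟩ := (hp.prime.dvd_finsetProd_iff _).1 (hiff.2 hem)
      have h0 : (p : ℤ) ^ m ∣ 1 - (a : ℤ) ^ (p - i₀) * a ^ (i₀ : ℕ) := by
        rw [← pow_add, Nat.sub_add_cancel i₀.2.le, ← neg_sub]
        exact ((hcast ▸ Dvd.intro_left _ rfl : (p : ℤ) ^ m ∣ (n * p ^ m : ℕ)).trans
          h.pow_eq).neg_right
      have hle := (h.dvd_one_sub_iff _ i₀ (m - 1) le_rfl).1
        ((pow_dvd_pow (p : ℤ) (Nat.sub_le m 1)).trans h0)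
      refine ⟨(a : ℤ) ^ (p - i₀), ?_, ?_, fun i => ⟨fun hi => ?_, fun hi => ?_⟩⟩
      · refine Int.gcd_prime_pow_eq_one hp (fun hd => hpZ.not_dvd_one ?_) m
        have := dvd_add ((dvd_pow_self (p : ℤ) (by omega : m - 1 ≠ 0)).trans hle) hd
        rwa [sub_add_cancel] at this
      · rw [hem]
        exact Nat.gcd_eq_right (Int.natCast_dvd.1 (by exact_mod_cast hle))
      · rwa [Fin.ext (h.index_unique i.2 i₀.2 hi h0)]
      · have : i = i₀ := by
          by_contra hne
          exact hp.ne_one (Nat.dvd_one.1 ((hcop i i₀ hne) ▸ Nat.dvd_gcd hi hi₀))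
        rwa [this]
    · have hg : Int.gcd (1 - (1 + (p : ℤ) ^ e)) (p ^ (m - 1) : ℕ) = p ^ e := by
        rw [show 1 - (1 + (p : ℤ) ^ e) = -(p : ℤ) ^ e by ring, Int.neg_gcd]
        exact_mod_cast Nat.gcd_eq_left (pow_dvd_pow p he)
      refine ⟨1 + (p : ℤ) ^ e, Int.gcd_prime_pow_eq_one hp (fun hd => ?_) m, hg, fun i =>
        ⟨fun hi => absurd ?_ hem, fun hi =>
          absurd (hiff.1 (hi.trans (Finset.dvd_prod_of_mem d (Finset.mem_univ i)))) hem⟩⟩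
      · rcases Nat.eq_zero_or_pos e with rfl | he0
        · have h5 : p ∣ 2 := by exact_mod_cast (by simpa using hd : (p : ℤ) ∣ 1 + 1)
          have := he2 ((Nat.prime_dvd_prime_iff_eq hp Nat.prime_two).1 h5)
          omega
        · exact hpZ.not_dvd_one ((dvd_add_left (dvd_pow_self _ he0.ne')).1 hd)
      · have hle := (h.dvd_one_sub_iff _ i (m - 1) le_rfl).1
          ((pow_dvd_pow (p : ℤ) (Nat.sub_le m 1)).trans hi)
        have h4 : p ^ (m - 1) ∣ p ^ e := by
          rw [← hg]
          exact Int.dvd_gcd (by exact_mod_cast hle) dvd_rfl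
        have := (Nat.pow_dvd_pow_iff_le_right hp.one_lt).1 h4
        omega
  have hnpm : n.Coprime (p ^ m) := h.coprime.pow_right m
  obtain ⟨s, hs1, hs2⟩ := Int.exists_dvd_sub_of_coprime hnpm s₁ s₂
  have key : ∀ (x : ℤ) (i : ℕ), 1 - s * (a : ℤ) ^ i - (1 - x * (a : ℤ) ^ i) =
    -((s - x) * a ^ i) := fun x i => by ring
  have hse : Int.gcd (1 - s) (p ^ (m - 1) : ℕ) = p ^ e := by
    rw [← h2e]
    refine Int.gcd_eq_of_dvd_sub ?_
    rw [show 1 - s - (1 - s₂) = -(s - s₂) by ring]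
    exact ((Int.natCast_dvd_natCast.2 (pow_dvd_pow p (Nat.sub_le m 1))).trans hs2).neg_right
  refine ⟨s, ?_, hse, fun i => ?_⟩
  · rw [Int.gcd_mul_of_coprime _ hnpm, Int.gcd_eq_of_dvd_sub hs1, Int.gcd_eq_of_dvd_sub hs2,
      h1, h2]
  · have hpi : (p : ℤ) ^ m ∣ 1 - s * (a : ℤ) ^ (i : ℕ) ↔ p ∣ d i := by
      rw [← h2' i]
      refine (dvd_iff_dvd_of_dvd_sub ?_)
      rw [key]
      exact_mod_cast (hs2.mul_right _).neg_right
    rw [h.gcd_one_sub_mul, hse, Int.gcd_eq_of_dvd_sub (y := 1 - s₁ * (a : ℤ) ^ (i : ℕ))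
      (by rw [key]; exact (hs1.mul_right _).neg_right), h1']
    congr 1
    have h5 : (d i).gcd p = if (p : ℤ) ^ m ∣ 1 - s * (a : ℤ) ^ (i : ℕ) then p else 1 := by
      split_ifs with h6
      · exact Nat.gcd_eq_right (hpi.1 h6)
      · exact ((hp.coprime_iff_not_dvd.2 (mt hpi.2 h6)).symm)
    rw [← h5, ← h.coprime.gcd_mul]
    exact Nat.gcd_eq_left (hdv i)

end IsModularExponent

/-! ### Counting twisted conjugacy classes. -/

/-- The group `G`, on which `G` acts by `φ`-twisted conjugation. -/
def TwistedConj {G : Type*} [Group G] (_ : MulAut G) : Type _ := G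

instance {G : Type*} [Group G] (φ : MulAut G) : MulAction G (TwistedConj φ) where
  smul g x := (fun z : G => g * z * (φ g)⁻¹) x
  one_smul := by
    intro (x : G)
    change 1 * x * (φ 1)⁻¹ = x
    simp
  mul_smul := by
    intro g h (x : G)
    change g * h * x * (φ (g * h))⁻¹ = g * (h * x * (φ h)⁻¹) * (φ g)⁻¹
    simp [mul_assoc]

/-- Burnside's lemma for twisted conjugation. -/
theorem card_twistedConj_mul_card {G : Type*} [Group G] (φ : MulAut G) :
    Nat.card {q : G × G // q.1 * q.2 * (φ q.1)⁻¹ = q.2} =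
      Nat.card (Quotient (twistedConj φ)) * Nat.card G := by
  have e : Quotient (MulAction.orbitRel G (TwistedConj φ)) ≃ Quotient (twistedConj φ) :=
    Quotient.congr (Equiv.refl G) fun x y => by
      change x ∈ MulAction.orbit G y ↔ _
      rw [MulAction.mem_orbit_iff]
      exact exists_congr fun g => ⟨Eq.symm, Eq.symm⟩
  rw [← Nat.card_congr e, ← Nat.card_prod]
  have e' : {q : G × G // q.1 * q.2 * (φ q.1)⁻¹ = q.2} ≃
      Σ g : G, MulAction.fixedBy (TwistedConj φ) g :=
    Equiv.subtypeProdEquivSigmaSubtype fun g x : G => g * x * (φ g)⁻¹ = x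
  exact Nat.card_congr
    (e'.trans (MulAction.sigmaFixedByEquivOrbitsProdGroup G (TwistedConj φ)))

/-! ### Two-variable equations in a finite cyclic group. -/

section Cyclic

variable {N : Type*} [CommGroup N]

/-- The homomorphism `(u, v) ↦ u ^ b * v ^ c`. -/
def zpowMulZPowHom (N : Type*) [CommGroup N] (b c : ℤ) : N × N →* N :=
  (zpowGroupHom b).coprod (zpowGroupHom c)

theorem zpowMulZPowHom_apply (b c : ℤ) (q : N × N) :
    zpowMulZPowHom N b c q = q.1 ^ b * q.2 ^ c := rfl

theorem pow_gcd_mem_range [Finite N] (b c : ℤ) (z : N) :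
    z ^ Int.gcd (Int.gcd b c) (Nat.card N) ∈ (zpowMulZPowHom N b c).range := by
  have h1 := Int.gcd_eq_gcd_ab (Int.gcd b c) (Nat.card N)
  have h2 := Int.gcd_eq_gcd_ab b c
  set X := Int.gcdA b c
  set Y := Int.gcdB b c
  set Z := Int.gcdA (Int.gcd b c) (Nat.card N)
  set W := Int.gcdB (Int.gcd b c) (Nat.card N)
  refine ⟨(z ^ (X * Z), z ^ (Y * Z)), ?_⟩
  rw [zpowMulZPowHom_apply, ← zpow_natCast z (Int.gcd (Int.gcd b c) (Nat.card N)), h1, zpow_add,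
    zpow_mul z (Nat.card N : ℤ), zpow_natCast, pow_card_eq_one', one_zpow, mul_one, h2,
    ← zpow_mul, ← zpow_mul, ← zpow_add]
  congr 1
  ring

/-- A non-empty fibre has the size of the kernel. With g the gcd, the image is generated by x^g and
has order |N| / g, so the kernel has order |N| g. -/
theorem card_zpow_mul_zpow_eq [IsCyclic N] [Finite N] (b c : ℤ) {w : N}
    (hw : w ∈ (zpowMulZPowHom N b c).range) :
    Nat.card {q : N × N // q.1 ^ b * q.2 ^ c = w} =
      Nat.card N * Int.gcd (Int.gcd b c) (Nat.card N) := by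
  obtain ⟨q, rfl⟩ := hw
  obtain ⟨x, hx⟩ := IsCyclic.exists_generator (α := N)
  have hxo : orderOf x = Nat.card N := orderOf_eq_card_of_forall_mem_zpowers hx
  set f := zpowMulZPowHom N b c with hf
  set g := Int.gcd (Int.gcd b c) (Nat.card N) with hg
  have hgN : g ∣ Nat.card N := Nat.gcd_dvd_right _ _
  have hN : 0 < Nat.card N := Nat.card_pos
  have hgb : (g : ℤ) ∣ b := (Int.gcd_dvd_left _ _).trans (Int.gcd_dvd_left _ _)
  have hgc : (g : ℤ) ∣ c := (Int.gcd_dvd_left _ _).trans (Int.gcd_dvd_right _ _)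
  have hr : f.range = Subgroup.zpowers (x ^ g) := by
    refine le_antisymm ?_ ?_
    · rintro _ ⟨⟨u, v⟩, rfl⟩
      obtain ⟨i, rfl⟩ := hx u
      obtain ⟨j, rfl⟩ := hx v
      obtain ⟨b', hb⟩ := hgb
      obtain ⟨c', hc⟩ := hgc
      refine ⟨i * b' + j * c', ?_⟩
      change (x ^ g) ^ (i * b' + j * c') = (x ^ i) ^ b * (x ^ j) ^ c
      rw [hb, hc, ← zpow_natCast x g, ← zpow_mul, ← zpow_mul, ← zpow_mul, ← zpow_add]
      congr 1
      ring
    · rw [Subgroup.zpowers_le]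
      exact pow_gcd_mem_range b c x
  have h1 : Nat.card f.ker * (Nat.card N / g) = Nat.card N * Nat.card N := by
    rw [← Nat.card_prod, ← f.ker.card_mul_index, Subgroup.index_ker, hr, Nat.card_zpowers,
      orderOf_pow, hxo, Nat.gcd_eq_right hgN]
  have h2 : Nat.card {q' : N × N // q'.1 ^ b * q'.2 ^ c = f q} = Nat.card f.ker :=
    Nat.card_congr (MonoidHom.fiberEquivKer f q)
  rw [h2]
  obtain ⟨k, hk⟩ := hgN
  have hg0 : 0 < g := Nat.pos_of_ne_zero fun h0 => by rw [h0, zero_mul] at hk; omega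
  have hk0 : 0 < k := Nat.pos_of_ne_zero fun h0 => by rw [h0, mul_zero] at hk; omega
  rw [hk, Nat.mul_div_cancel_left _ hg0] at h1
  rw [hk]
  refine Nat.eq_of_mul_eq_mul_right hk0 (h1.trans ?_)
  ring

end Cyclic

/-- The exponents of the fixed point equation for a pair of elements of the quotient `C_p`. -/
theorem IsModularExponent.gcd_gcd {n m p a β : ℕ} (h : IsModularExponent n m p a β) (s : ℤ) (i : ℕ)
    {k : ℕ} (hk : 0 < k) (hkp : k < p) :
    Int.gcd (Int.gcd (1 - s * (a : ℤ) ^ i) ((a : ℤ) ^ k - 1)) (n * p ^ m : ℕ) =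
      Int.gcd (1 - s) (p ^ (m - 1) : ℕ) := by
  rw [Int.gcd_assoc, h.gcd_pow_sub_one hk hkp, h.gcd_one_sub]

/-! ### Automorphisms of the semidirect product and their Reidemeister numbers. -/

section SemidirectProduct

open SemidirectProduct

variable {N C : Type*} [CommGroup N] [Group C] {n m p a β : ℕ}
  {α : C →* MulAut N} {y : C}

theorem aut_pow_apply (hα : ∀ g : N, α y g = g ^ a) (k : ℕ) (g : N) :
    α (y ^ k) g = g ^ a ^ k := by
  induction k generalizing g with
  | zero => simp
  | succ k ih => rw [pow_succ, map_mul, MulAut.mul_apply, hα, ih, ← pow_mul, ← pow_succ']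

theorem exists_pow_eq (hp : 0 < p) (hC : Nat.card C = p) (hy : Subgroup.zpowers y = ⊤) (c : C) :
    ∃ k < p, y ^ k = c := by
  have : Finite C := Nat.finite_of_card_ne_zero (by omega)
  have ho : orderOf y = p := by rw [← Nat.card_zpowers, hy, Subgroup.card_top, hC]
  have hc : c ∈ Subgroup.zpowers y := hy ▸ Subgroup.mem_top c
  obtain ⟨k, hk⟩ := (mem_powers_iff_mem_zpowers.2 hc)
  exact ⟨k % p, Nat.mod_lt _ hp, by rw [← ho, pow_mod_orderOf]; exact hk⟩

theorem bijective_pow (hp : 0 < p) (hC : Nat.card C = p) (hy : Subgroup.zpowers y = ⊤) :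
    Function.Bijective fun k : Fin p => y ^ (k : ℕ) := by
  have ho : orderOf y = p := by rw [← Nat.card_zpowers, hy, Subgroup.card_top, hC]
  refine ⟨fun i j hij => Fin.ext ?_, fun c => ?_⟩
  · exact pow_injOn_Iio_orderOf (by simp [ho]) (by simp [ho]) hij
  · obtain ⟨k, hk, rfl⟩ := exists_pow_eq hp hC hy c
    exact ⟨⟨k, hk⟩, rfl⟩

variable (h : IsModularExponent n m p a β)
include h

theorem eq_one_of_aut_apply_eq (hC : Nat.card C = p) (hy : Subgroup.zpowers y = ⊤)
    (hα : ∀ g : N, α y g = g ^ a) {c : C} (hc : c ≠ 1) {g : N} (hgn : g ^ n = 1)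
    (hg : α c g = g) : g = 1 := by
  obtain ⟨k, hk, rfl⟩ := exists_pow_eq h.prime.pos hC hy c
  have hk0 : 0 < k := Nat.pos_of_ne_zero fun h0 => hc (by rw [h0, pow_zero])
  rw [aut_pow_apply hα] at hg
  have h1 : (orderOf g : ℤ) ∣ (a : ℤ) ^ k - 1 := by
    rw [orderOf_dvd_iff_zpow_eq_one, zpow_sub, zpow_one, mul_inv_eq_one]
    exact_mod_cast hg
  have h2 := Int.dvd_gcd h1 (Int.natCast_dvd_natCast.2 (orderOf_dvd_of_pow_eq_one hgn))
  rw [h.gcd_pow_sub_one_eq_one hk0 hk] at h2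
  exact orderOf_eq_one_iff.1 (Nat.dvd_one.1 h2)

theorem exists_ne_one_pow_eq_one [IsCyclic N] (hn : 2 ≤ n) (hN : Nat.card N = n * p ^ m) :
    ∃ g : N, g ≠ 1 ∧ g ^ n = 1 := by
  obtain ⟨x, hx⟩ := IsCyclic.exists_generator (α := N)
  have hxo : orderOf x = n * p ^ m := (orderOf_eq_card_of_forall_mem_zpowers hx).trans hN
  have hpm : 0 < p ^ m := pow_pos h.prime.pos m
  refine ⟨x ^ p ^ m, fun h1 => ?_, ?_⟩
  · have := Nat.le_of_dvd hpm (hxo ▸ orderOf_dvd_of_pow_eq_one h1)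
    nlinarith
  · rw [← pow_mul, mul_comm, ← hxo, pow_orderOf_eq_one]

theorem eq_one_of_pow_eq_one (hC : Nat.card C = p) {c : C} (hc : c ^ n = 1) : c = 1 := by
  have h1 := orderOf_dvd_of_pow_eq_one hc
  have h2 : orderOf c ∣ p := hC ▸ orderOf_dvd_natCard c
  exact orderOf_eq_one_iff.1 (Nat.dvd_one.1 (h.coprime ▸ Nat.dvd_gcd h1 h2))

variable [IsCyclic N] (hn : 2 ≤ n) (hN : Nat.card N = n * p ^ m) (hC : Nat.card C = p)
  (hy : Subgroup.zpowers y = ⊤) (hα : ∀ g : N, α y g = g ^ a) (φ : MulAut (N ⋊[α] C))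
include hn hN hC hy hα

/-- Take n-torsion g ≠ 1 in N, available as n ≥ 2. Its image is n-torsion and lies in N, since C has
order prime to n. It commutes with φ(u), so a non-trivial C-component of φ(u) would fix it, against
freeness. -/
theorem map_inl_right (u : N) : (φ (inl u)).right = 1 := by
  obtain ⟨g, hg1, hgn⟩ := exists_ne_one_pow_eq_one h hn hN
  have hr : (φ (inl g)).right = 1 := by
    refine eq_one_of_pow_eq_one h hC ?_
    change (rightHom (φ (inl g))) ^ n = 1
    rw [← map_pow, ← map_pow, ← map_pow, hgn]
    simp
  have hgl : φ (inl g) = inl (φ (inl g)).left := by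
    ext
    · rfl
    · simpa using hr
  have hln : (φ (inl g)).left ^ n = 1 := by
    apply inl_injective (φ := α)
    rw [map_pow, ← hgl, ← map_pow, ← map_pow, hgn]
    simp
  by_contra hu
  refine hg1 ?_
  have h1 : (φ (inl g)).left = 1 := by
    refine eq_one_of_aut_apply_eq h hC hy hα hu hln ?_
    have hcomm : φ (inl u) * φ (inl g) = φ (inl g) * φ (inl u) := by
      rw [← map_mul, ← map_mul, ← map_mul, ← map_mul, mul_comm]
    have hl := congrArg SemidirectProduct.left hcomm
    rw [mul_left, mul_left, hr, map_one, MulAut.one_apply, mul_comm] at hl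
    exact mul_right_cancel hl
  rw [h1, map_one] at hgl
  have := φ.injective (hgl.trans (map_one φ).symm)
  exact inl_injective (this.trans (map_one _).symm)

/-- Endomorphisms of a cyclic group are power maps, and injectivity makes the exponent prime to the
order. -/
theorem exists_map_inl : ∃ s : ℤ, Int.gcd s (n * p ^ m : ℕ) = 1 ∧ ∀ u : N,
    φ (inl u) = inl (u ^ s) := by
  have hr := map_inl_right h hn hN hC hy hα φ
  have hinl : ∀ u : N, φ (inl u) = inl (φ (inl u)).left := fun u => by
    ext
    · rfl
    · simpa using hr u
  let f : N →* N :=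
    { toFun := fun u => (φ (inl u)).left
      map_one' := by simp
      map_mul' := fun u v => by
        rw [map_mul, map_mul, mul_left, hr, map_one, MulAut.one_apply] }
  obtain ⟨s, hs⟩ := f.map_cyclic
  have hs' : ∀ u : N, φ (inl u) = inl (u ^ s) := fun u => by
    rw [hinl, ← hs u]; rfl
  refine ⟨s, ?_, hs'⟩
  obtain ⟨x, hx⟩ := IsCyclic.exists_generator (α := N)
  have hxo : orderOf x = n * p ^ m := (orderOf_eq_card_of_forall_mem_zpowers hx).trans hN
  have h0 : 0 < n * p ^ m := Nat.mul_pos h.n_pos (pow_pos h.prime.pos m)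
  set g := Int.gcd s (n * p ^ m : ℕ) with hg
  have hgd : g ∣ n * p ^ m := Nat.gcd_dvd_right _ _
  obtain ⟨k, hk⟩ := hgd
  obtain ⟨s', hs''⟩ : (g : ℤ) ∣ s := Int.gcd_dvd_left _ _
  have h1 : x ^ k = 1 := by
    apply inl_injective (φ := α)
    apply φ.injective
    rw [hs', map_one, map_one, ← zpow_natCast, ← zpow_mul, hs'',
      show (k : ℤ) * (g * s') = ((g * k : ℕ) : ℤ) * s' by push_cast; ring, zpow_mul, zpow_natCast,
      ← hk, ← hxo, pow_orderOf_eq_one, one_zpow, map_one]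
  have h2 := orderOf_dvd_of_pow_eq_one h1
  rw [hxo, hk] at h2
  have hk0 : 0 < k := Nat.pos_of_ne_zero fun h0 => by rw [h0, mul_zero] at hk; omega
  have h3 := Nat.le_of_dvd hk0 h2
  have hg0 : 0 < g := Nat.pos_of_ne_zero fun h0 => by rw [h0, zero_mul] at hk; omega
  by_contra hne
  have : 2 ≤ g := by omega
  nlinarith

/-- The power map φ on N commutes with the action, so c and the C-component of φ(c) act alike on g^s
for n-torsion g; freeness then identifies them. -/
theorem map_inr_right (c : C) : (φ (inr c)).right = c := by
  obtain ⟨s, hs, hφ⟩ := exists_map_inl h hn hN hC hy hα φ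
  obtain ⟨g, hg1, hgn⟩ := exists_ne_one_pow_eq_one h hn hN
  by_contra hne
  have hr : c⁻¹ * (φ (inr c)).right ≠ 1 := fun h1 => hne (inv_mul_eq_one.1 h1).symm
  have h1 : g ^ s = 1 := by
    refine eq_one_of_aut_apply_eq h hC hy hα hr ?_ ?_
    · rw [← zpow_natCast, ← zpow_mul, mul_comm, zpow_mul, zpow_natCast, hgn, one_zpow]
    · rw [map_mul, MulAut.mul_apply, map_inv, MulAut.inv_apply, MulEquiv.symm_apply_eq]
      have e : φ (inr c) * φ (inl g) = φ (inl (α c g)) * φ (inr c) := by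
        rw [← map_mul, ← map_mul, inl_aut, map_inv]
        simp
      rw [hφ, hφ, ← map_zpow] at e
      have hl := congrArg SemidirectProduct.left e
      rw [mul_left, mul_left, left_inl, left_inl, right_inl, map_one, MulAut.one_apply,
        mul_comm] at hl
      exact mul_right_cancel hl
  refine hg1 (inl_injective (φ := α) (φ.injective ?_))
  rw [hφ, h1, map_one, map_one]

/-- If φ(y) = x^t y, then y^p = 1 kills x^(t ∑ a^j), and `dvd_of_dvd_mul_geom_sum` gives p^(m-1) ∣
t. This divisibility is what makes the fixed point equations soluble. -/
theorem exists_map_inr (c : C) :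
    ∃ z : N, φ (inr c) = inl (z ^ p ^ (m - 1)) * inr c := by
  have hr := map_inr_right h hn hN hC hy hα φ
  have hpp := h.prime.pos
  obtain ⟨x, hx⟩ := IsCyclic.exists_generator (α := N)
  have hxo : orderOf x = n * p ^ m := (orderOf_eq_card_of_forall_mem_zpowers hx).trans hN
  have hinr : ∀ c, φ (inr c) = inl (φ (inr c)).left * inr c := fun c => by
    ext
    · simp
    · simpa using hr c
  have hyp : y ^ p = 1 := by
    have : orderOf y ∣ p := hC ▸ orderOf_dvd_natCard y
    exact orderOf_dvd_iff_pow_eq_one.1 this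
  have hgen : ∃ z : N, φ (inr y) = inl (z ^ p ^ (m - 1)) * inr y := by
    obtain ⟨t, ht⟩ := hx (φ (inr y)).left
    have hpow : ∀ k : ℕ, φ (inr y) ^ k =
        inl (x ^ (t * ∑ j ∈ Finset.range k, (a : ℤ) ^ j)) * inr (y ^ k) := fun k => by
      induction k with
      | zero => simp
      | succ k ih =>
        have hxt : x ^ t = (φ (inr y)).left := ht
        rw [pow_succ, ih, hinr y, ← hxt]
        ext
        · simp only [mul_left, left_inl, right_inl, left_inr, right_inr, mul_right, map_one,
            one_mul, mul_one, aut_pow_apply hα]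
          rw [← zpow_natCast, ← zpow_mul, ← zpow_add, Finset.sum_range_succ]
          congr 1
          push_cast
          ring
        · simp only [mul_right, right_inl, right_inr, one_mul, pow_succ]
    have h1 : x ^ (t * ∑ j ∈ Finset.range p, (a : ℤ) ^ j) = 1 := by
      have := hpow p
      rw [hyp, ← map_pow, ← map_pow, hyp] at this
      apply inl_injective (φ := α)
      simpa using this.symm
    rw [← orderOf_dvd_iff_zpow_eq_one, hxo] at h1
    obtain ⟨t', rfl⟩ := h.dvd_of_dvd_mul_geom_sum ((by push_cast; exact Dvd.intro_left _ rfl :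
      (p : ℤ) ^ m ∣ ((n * p ^ m : ℕ) : ℤ)).trans h1)
    refine ⟨x ^ t', ?_⟩
    rw [hinr y, ← ht]
    congr 2
    change x ^ ((p : ℤ) ^ (m - 1) * t') = _
    rw [mul_comm, zpow_mul]
    exact_mod_cast rfl
  obtain ⟨z, hz⟩ := hgen
  obtain ⟨k, -, rfl⟩ := exists_pow_eq hpp hC hy c
  induction k with
  | zero => exact ⟨1, by simp⟩
  | succ k ih =>
    obtain ⟨w, hw⟩ := ih
    refine ⟨w * z ^ a ^ k, ?_⟩
    rw [pow_succ, map_mul, map_mul, hw, hz]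
    ext
    · simp only [mul_left, left_inl, right_inl, left_inr, right_inr, mul_right, map_one,
        MulAut.one_apply, one_mul, mul_one, aut_pow_apply hα]
      rw [mul_pow, ← pow_mul, ← pow_mul, mul_comm (p ^ (m - 1)), one_pow, mul_one]
    · simp only [mul_right, right_inl, right_inr, one_mul]

/-- The shape of the automorphisms of the semidirect product. -/
theorem exists_forall_mulAut_apply_eq : ∃ (s : ℤ) (ζ : C → N), Int.gcd s (n * p ^ m : ℕ) = 1 ∧
    ∀ g, φ g = ⟨g.left ^ s * ζ g.right ^ p ^ (m - 1), g.right⟩ := by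
  obtain ⟨s, hs, hl⟩ := exists_map_inl h hn hN hC hy hα φ
  choose ζ hζ using exists_map_inr h hn hN hC hy hα φ
  refine ⟨s, ζ, hs, fun g => ?_⟩
  conv_lhs => rw [← inl_left_mul_inr_right g, map_mul, hl, hζ]
  ext
  · simp only [mul_left, left_inl, right_inl, left_inr, map_one, MulAut.one_apply, mul_one]
  · simp only [mul_right, right_inl, right_inr, one_mul]

omit hn in
-- Burnside's count divided by |N|: for each i, k = 0 contributes the first gcd and each of the p -
-- 1 other k the second. The result does not involve ζ.
theorem card_quotient_mul {s : ℤ} {ζ : C → N}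
    (hφ : ∀ g, φ g = ⟨g.left ^ s * ζ g.right ^ p ^ (m - 1), g.right⟩) :
    Nat.card (Quotient (twistedConj φ)) * p =
      ∑ i : Fin p, (Int.gcd (1 - s * (a : ℤ) ^ (i : ℕ)) (n * p ^ m : ℕ) +
        (p - 1) * Int.gcd (1 - s) (p ^ (m - 1) : ℕ)) := by
  have hpp := h.prime.pos
  have h0 : 0 < n * p ^ m := Nat.mul_pos h.n_pos (pow_pos hpp m)
  have : Finite N := Nat.finite_of_card_ne_zero (by omega)
  have hbij := bijective_pow hpp hC hy
  let F : Fin p × Fin p → Type _ := fun r => {q : N × N //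
    q.1 ^ (1 - s * (a : ℤ) ^ (r.2 : ℕ)) * q.2 ^ ((a : ℤ) ^ (r.1 : ℕ) - 1) =
      (ζ (y ^ (r.1 : ℕ)) ^ p ^ (m - 1)) ^ a ^ (r.2 : ℕ)}
  have hiff : ∀ (r : Fin p × Fin p) (u v : N),
      u ^ (1 - s * (a : ℤ) ^ (r.2 : ℕ)) * v ^ ((a : ℤ) ^ (r.1 : ℕ) - 1) =
        (ζ (y ^ (r.1 : ℕ)) ^ p ^ (m - 1)) ^ a ^ (r.2 : ℕ) ↔
      (⟨u, y ^ (r.1 : ℕ)⟩ : N ⋊[α] C) * ⟨v, y ^ (r.2 : ℕ)⟩ * (φ ⟨u, y ^ (r.1 : ℕ)⟩)⁻¹ =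
        ⟨v, y ^ (r.2 : ℕ)⟩ := by
    intro r u v
    rw [mul_inv_eq_iff_eq_mul, hφ, SemidirectProduct.ext_iff]
    simp only [mul_left, mul_right, aut_pow_apply hα]
    rw [and_iff_left (by rw [← pow_add, ← pow_add, add_comm]), mul_pow, zpow_sub, zpow_sub,
      zpow_one, zpow_one, zpow_mul]
    generalize (ζ (y ^ (r.1 : ℕ)) ^ p ^ (m - 1)) ^ a ^ (r.2 : ℕ) = w
    rw [show (a : ℤ) ^ (r.2 : ℕ) = ((a ^ (r.2 : ℕ) : ℕ) : ℤ) by push_cast; rfl,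
      show (a : ℤ) ^ (r.1 : ℕ) = ((a ^ (r.1 : ℕ) : ℕ) : ℤ) by push_cast; rfl, zpow_natCast,
      zpow_natCast]
    generalize (u ^ s) ^ a ^ (r.2 : ℕ) = u'
    generalize v ^ a ^ (r.1 : ℕ) = v'
    rw [show u * u'⁻¹ * (v' * v⁻¹) = u * v' * (v * u')⁻¹ by
      rw [mul_inv_rev, mul_mul_mul_comm], mul_inv_eq_iff_eq_mul,
      show w * (v * u') = v * (u' * w) by simp only [mul_comm, mul_left_comm]]
  have hsig : Nat.card (Σ r, F r) =
      Nat.card {q : (N ⋊[α] C) × (N ⋊[α] C) // q.1 * q.2 * (φ q.1)⁻¹ = q.2} := by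
    refine Nat.card_congr (Equiv.ofBijective (fun q => ⟨(⟨q.2.1.1, y ^ (q.1.1 : ℕ)⟩,
      ⟨q.2.1.2, y ^ (q.1.2 : ℕ)⟩), (hiff q.1 _ _).1 q.2.2⟩) ⟨?_, ?_⟩)
    · rintro ⟨⟨k, i⟩, ⟨⟨u, v⟩, huv⟩⟩ ⟨⟨k', i'⟩, ⟨⟨u', v'⟩, huv'⟩⟩ heq
      simp only [Subtype.mk.injEq, Prod.mk.injEq, SemidirectProduct.ext_iff] at heq
      obtain ⟨⟨rfl, hk⟩, rfl, hi⟩ := heq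
      obtain rfl := hbij.1 hk
      obtain rfl := hbij.1 hi
      rfl
    · rintro ⟨⟨⟨u, c⟩, ⟨v, d⟩⟩, hq⟩
      obtain ⟨k, rfl⟩ := hbij.2 c
      obtain ⟨i, rfl⟩ := hbij.2 d
      exact ⟨⟨(k, i), ⟨(u, v), (hiff (k, i) u v).2 hq⟩⟩, rfl⟩
  have hζ1 : ζ 1 ^ p ^ (m - 1) = 1 := by
    have := congrArg SemidirectProduct.left (hφ 1)
    rw [map_one] at this
    simpa using this.symm
  have hF : ∀ r, Nat.card (F r) = (n * p ^ m) * if (r.1 : ℕ) = 0 then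
      Int.gcd (1 - s * (a : ℤ) ^ (r.2 : ℕ)) (n * p ^ m : ℕ) else
      Int.gcd (1 - s) (p ^ (m - 1) : ℕ) := by
    rintro ⟨k, i⟩
    have hw : (ζ (y ^ (k : ℕ)) ^ p ^ (m - 1)) ^ a ^ (i : ℕ) ∈
        (zpowMulZPowHom N (1 - s * (a : ℤ) ^ (i : ℕ)) ((a : ℤ) ^ (k : ℕ) - 1)).range := by
      refine pow_mem ?_ _
      by_cases hk : (k : ℕ) = 0
      · rw [show y ^ (k : ℕ) = 1 by rw [hk, pow_zero], hζ1]
        exact one_mem _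
      -- For k ≠ 0 the gcd of the exponents with |N| divides p^(m-1), so a p^(m-1)-th power lies in
      -- the image.
      · obtain ⟨l, hl⟩ : Int.gcd (1 - s) (p ^ (m - 1) : ℕ) ∣ p ^ (m - 1) := Nat.gcd_dvd_right _ _
        have hm := pow_gcd_mem_range (1 - s * (a : ℤ) ^ (i : ℕ)) ((a : ℤ) ^ (k : ℕ) - 1)
          (ζ (y ^ (k : ℕ)))
        rw [hN, h.gcd_gcd s i (Nat.pos_of_ne_zero hk) k.2] at hm
        rw [hl, pow_mul]
        exact pow_mem hm l
    refine (card_zpow_mul_zpow_eq _ _ hw).trans ?_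
    rw [hN]
    congr 1
    split_ifs with hk
    · change (k : ℕ) = 0 at hk
      simp only [hk, pow_zero, sub_self]
      rw [Int.gcd_assoc, Int.zero_gcd, Int.natAbs_natCast]
    · exact h.gcd_gcd s i (Nat.pos_of_ne_zero hk) k.2
  have hB := card_twistedConj_mul_card φ
  rw [← hsig, Nat.card_sigma, SemidirectProduct.card, hN, hC,
    Finset.sum_congr rfl fun r _ => hF r, ← Finset.mul_sum, Fintype.sum_prod_type_right] at hB
  refine Nat.eq_of_mul_eq_mul_left h0 (Eq.trans ?_ (hB.symm.trans ?_))
  · ring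
  · congr 1
    refine Finset.sum_congr rfl fun i _ => ?_
    obtain ⟨p', rfl⟩ : ∃ p', p = p' + 1 := ⟨p - 1, by omega⟩
    rw [Fin.sum_univ_succ]
    simp

omit h hn hC hy hα [IsCyclic N] in
theorem exists_mulAut_apply_eq (h0 : 0 < n * p ^ m) {s : ℤ}
    (hs : Int.gcd s (n * p ^ m : ℕ) = 1) (hcomm : ∀ c (u : N), (α c u) ^ s = α c (u ^ s)) :
    ∃ φ : MulAut (N ⋊[α] C), ∀ g, φ g = ⟨g.left ^ s, g.right⟩ := by
  have : Finite N := Nat.finite_of_card_ne_zero (by omega)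
  have hinj : Function.Injective (zpowGroupHom s : N →* N) := by
    rw [injective_iff_map_eq_one]
    intro u hu
    have h1 : (orderOf u : ℤ) ∣ s := orderOf_dvd_iff_zpow_eq_one.2 hu
    have h2 := Int.dvd_gcd h1 (Int.natCast_dvd_natCast.2 (hN ▸ orderOf_dvd_natCard u))
    rw [hs] at h2
    exact orderOf_eq_one_iff.1 (Nat.dvd_one.1 h2)
  refine ⟨SemidirectProduct.congr
    (MulEquiv.ofBijective _ (Finite.injective_iff_bijective.1 hinj)) (MulEquiv.refl C) ?_, ?_⟩
  · intro c
    ext u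
    exact hcomm c u
  · exact fun g => rfl

end SemidirectProduct

/-! ### The spectrum, with all three cases in one formula. -/

section Spectrum

variable {N C : Type*} [CommGroup N] [IsCyclic N] [Group C] {n m p a β : ℕ}
  {α : C →* MulAut N} {y : C}

theorem image_reidemeisterSpectrum (h : IsModularExponent n m p a β) (hn : 2 ≤ n)
    (hN : Nat.card N = n * p ^ m) (hC : Nat.card C = p) (hy : Subgroup.zpowers y = ⊤)
    (hα : ∀ g : N, α y g = g ^ a) :
    (fun r : ℕ∞ => (r.toNat : ℚ)) '' reidemeisterSpectrum (N ⋊[α] C) =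
      {q | ∃ e : ℕ, ∃ d ∈ divisorTuples (n * p) p, e ≤ m - 1 ∧ (p ∣ ∏ i, d i ↔ e = m - 1) ∧
        (p = 2 → 1 ≤ e) ∧ (p = 2 → 3 ∣ n → ∃ i, 3 ∣ d i) ∧
        q = (p : ℚ) ^ (e + 1) + (p : ℚ) ^ e * ∑ i, ((d i : ℚ) - 1) / (p : ℚ)} := by
  have hp0 : (p : ℚ) ≠ 0 := by exact_mod_cast h.prime.ne_zero
  have h0 : 0 < n * p ^ m := Nat.mul_pos h.n_pos (pow_pos h.prime.pos m)
  have : Finite N := Nat.finite_of_card_ne_zero (by omega)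
  have : Finite C := Nat.finite_of_card_ne_zero (by have := h.prime.pos; omega)
  have : Finite (N ⋊[α] C) := Finite.of_equiv _ SemidirectProduct.equivProd.symm
  have key : ∀ (φ : MulAut (N ⋊[α] C)) (s : ℤ) (ζ : C → N) (e : ℕ) (d : Fin p → ℕ),
      (∀ g, φ g = ⟨g.left ^ s * ζ g.right ^ p ^ (m - 1), g.right⟩) →
      Int.gcd (1 - s) (p ^ (m - 1) : ℕ) = p ^ e →
      (∀ i : Fin p, Int.gcd (1 - s * (a : ℤ) ^ (i : ℕ)) (n * p ^ m : ℕ) = p ^ e * d i) →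
      ((reidemeisterNumber φ).toNat : ℚ) =
        (p : ℚ) ^ (e + 1) + (p : ℚ) ^ e * ∑ i, ((d i : ℚ) - 1) / (p : ℚ) := by
    intro φ s ζ e d hφ he hd
    have h1 := card_quotient_mul h hN hC hy hα φ hφ
    rw [Finset.sum_congr rfl fun i _ => by rw [hd i, he], Finset.sum_add_distrib,
      ← Finset.mul_sum, Finset.sum_const, Finset.card_univ, Fintype.card_fin, smul_eq_mul] at h1
    have h2 : (Nat.card (Quotient (twistedConj φ)) : ℚ) * p =
        p ^ e * ∑ i, (d i : ℚ) + p * ((p - 1) * p ^ e) := by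
      have := congrArg (Nat.cast : ℕ → ℚ) h1
      push_cast [Nat.cast_sub h.prime.one_lt.le] at this
      exact this
    rw [reidemeisterNumber, ENat.card_eq_coe_natCard, ENat.toNat_natCast, ← Finset.sum_div,
      Finset.sum_sub_distrib, eq_div_of_mul_eq hp0 h2]
    simp only [Finset.sum_const, Finset.card_univ, Fintype.card_fin, nsmul_eq_mul, mul_one]
    field_simp
    ring
  ext q
  constructor
  · rintro ⟨_, ⟨φ, rfl⟩, rfl⟩
    obtain ⟨s, ζ, hs, hφ⟩ := exists_forall_mulAut_apply_eq h hn hN hC hy hα φ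
    obtain ⟨e, d, hd, he, hiff, hge, hgd, h2, h3⟩ := h.exists_tuple hs
    exact ⟨e, d, hd, he, hiff, h2, h3, key φ s ζ e d hφ hge hgd⟩
  · rintro ⟨e, d, hd, he, hiff, h2, h3, rfl⟩
    obtain ⟨s, hs, hge, hgd⟩ := h.exists_unit_of_tuple he hd hiff h2 h3
    -- Automorphisms with ζ = 1 suffice, because the Reidemeister number depends on s alone.
    obtain ⟨φ, hφ⟩ := exists_mulAut_apply_eq (α := α) hN h0 hs fun c u => (map_zpow (α c) u s).symm
    exact ⟨_, ⟨φ, rfl⟩, key φ s 1 e d (fun g => by simp [hφ]) hge hgd⟩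

end Spectrum

/-! ### From the group hypotheses to arithmetic, and the conclusion. -/

theorem IsSMC.isModularExponent {A B C : Type*} [CommGroup A] [CommGroup B] [Group C]
    {n m p : ℕ} {α : C →* MulAut (A × B)} (hG : IsSMC n m p α) (hm : 1 ≤ m)
    (hm2 : p = 2 → 3 ≤ m) {y : C} (hy : Subgroup.zpowers y = ⊤)
    {a : ℕ} (ha : ∀ g : A × B, α y g = g ^ a) {β : ℕ} (hβ1 : 1 ≤ β) (hβ2 : β ≤ p - 1)
    (haβ : a ≡ β * p ^ (m - 1) + 1 [MOD p ^ m]) :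
    IsCyclic (A × B) ∧ Nat.card (A × B) = n * p ^ m ∧ IsModularExponent n m p a β := by
  have hp := hG.prime
  have hcyc : IsCyclic (A × B) := Group.isCyclic_prod_iff.2 ⟨hG.cyclic_A, hG.cyclic_B, by
    rw [hG.card_A, hG.card_B]; exact hG.coprime.pow_right m⟩
  have hcard : Nat.card (A × B) = n * p ^ m := by rw [Nat.card_prod, hG.card_A, hG.card_B]
  have hyo : orderOf y = p := by rw [← Nat.card_zpowers, hy, Subgroup.card_top, hG.card_C]
  have hmod : (p : ℤ) ^ m ∣ (a : ℤ) - (β * p ^ (m - 1) + 1) := by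
    have := (Nat.modEq_iff_dvd.1 haβ.symm)
    exact_mod_cast this
  have hpow : ((n * p ^ m : ℕ) : ℤ) ∣ (a : ℤ) ^ p - 1 := by
    obtain ⟨x, hx⟩ := IsCyclic.exists_generator (α := A × B)
    have hxo : orderOf x = n * p ^ m := (orderOf_eq_card_of_forall_mem_zpowers hx).trans hcard
    have h1 := aut_pow_apply ha p x
    rw [← hyo, pow_orderOf_eq_one, hyo, map_one, MulAut.one_apply] at h1
    rw [← hxo, orderOf_dvd_iff_zpow_eq_one, zpow_sub, zpow_one, mul_inv_eq_one]
    exact_mod_cast h1.symm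
  refine ⟨hcyc, hcard, ⟨hG.n_pos, hp, hG.coprime, ?_, hm2, hβ1, by have := hp.pos; omega, hmod,
    hpow, fun q hq hqn k hk hkp hd => ?_⟩⟩
  -- For m = 1, Fermat gives a ≡ a^p ≡ 1 modulo p, whereas a ≡ β + 1 with 0 < β < p.
  · by_contra hlt
    obtain rfl : m = 1 := by omega
    have : Fact p.Prime := ⟨hp⟩
    have h1 : (p : ℤ) ∣ (a : ℤ) ^ p - 1 := by
      refine dvd_trans ?_ hpow
      exact_mod_cast Dvd.intro_left n (by rw [pow_one])
    rw [← ZMod.intCast_zmod_eq_zero_iff_dvd] at h1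
    rw [pow_one, ← ZMod.intCast_zmod_eq_zero_iff_dvd] at hmod
    push_cast at h1 hmod
    rw [ZMod.pow_card] at h1
    have h2 : (β : ZMod p) = 0 := by
      simp only [pow_zero, mul_one] at hmod
      linear_combination h1 - hmod
    rw [ZMod.natCast_eq_zero_iff] at h2
    have := Nat.le_of_dvd hβ1 h2
    have := hp.pos
    omega
  · have : Fact q.Prime := ⟨hq⟩
    have : Finite A := Nat.finite_of_card_ne_zero (by have := hG.n_pos; rw [hG.card_A]; omega)
    -- If q ∣ a^k - 1, an element of order q in A is fixed by y^k, contradicting freeness.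
    obtain ⟨g, hg⟩ := exists_prime_orderOf_dvd_card' (G := A) q (hG.card_A.symm ▸ hqn)
    rw [← hg, orderOf_dvd_iff_zpow_eq_one, zpow_sub, zpow_one, mul_inv_eq_one] at hd
    have h1 : g = 1 := by
      refine hG.free (y ^ k) (fun h1 => ?_) g ?_
      · have := Nat.le_of_dvd hk (orderOf_dvd_of_pow_eq_one h1)
        omega
      · rw [aut_pow_apply ha, Prod.pow_mk, one_pow]
        exact congrArg (fun z => (z, (1 : B))) (by exact_mod_cast hd)
    rw [h1, orderOf_one] at hg
    exact hq.ne_one hg.symm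

theorem reidemeisterSpectrum_of_comm {A B C : Type*} [CommGroup A] [CommGroup B] [Group C]
    (n m p : ℕ) (α : C →* MulAut (A × B)) (hG : IsSMC n m p α) (hn : 2 ≤ n) (hm : 1 ≤ m)
    (hm2 : p = 2 → 3 ≤ m)
    (y : C) (hy : Subgroup.zpowers y = ⊤)
    (a : ℕ) (ha : ∀ g : A × B, α y g = g ^ a)
    (β : ℕ) (hβ1 : 1 ≤ β) (hβ2 : β ≤ p - 1)
    (haβ : a ≡ β * p ^ (m - 1) + 1 [MOD p ^ m]) :
    2 ≤ m ∧
    (∀ r ∈ reidemeisterSpectrum ((A × B) ⋊[α] C), r ≠ ⊤) ∧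
    (p ≠ 2 →
      (fun r : ℕ∞ => (r.toNat : ℚ)) '' reidemeisterSpectrum ((A × B) ⋊[α] C) =
        candidateSet m p 0 (divisorTuples (n * p) p)) ∧
    (p = 2 → ¬ 3 ∣ n →
      (fun r : ℕ∞ => (r.toNat : ℚ)) '' reidemeisterSpectrum ((A × B) ⋊[α] C) =
        candidateSet m p 1 (divisorTuples (n * p) p)) ∧
    (p = 2 → 3 ∣ n →
      (fun r : ℕ∞ => (r.toNat : ℚ)) '' reidemeisterSpectrum ((A × B) ⋊[α] C) =
        candidateSet m p 1 (divisorTuplesThree (n * p) p)) := by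
  obtain ⟨hcyc, hcard, h⟩ := hG.isModularExponent hm hm2 hy ha hβ1 hβ2 haβ
  have h0 : 0 < n * p ^ m := Nat.mul_pos h.n_pos (pow_pos h.prime.pos m)
  have : Finite (A × B) := Nat.finite_of_card_ne_zero (by omega)
  have : Finite C := Nat.finite_of_card_ne_zero (by
    have := h.prime.pos; have := hG.card_C; omega)
  have : Finite ((A × B) ⋊[α] C) := Finite.of_equiv _ SemidirectProduct.equivProd.symm
  rw [image_reidemeisterSpectrum h hn hcard hG.card_C hy ha]
  refine ⟨h.two_le, ?_, fun hp2 => ?_, fun hp2 h3 => ?_, fun hp2 h3 => ?_⟩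
  · rintro _ ⟨φ, rfl⟩
    rw [reidemeisterNumber, ENat.card_eq_coe_natCard]
    exact ENat.natCast_ne_top _
  · ext q
    constructor
    · rintro ⟨e, d, hd, he, hiff, -, -, rfl⟩
      exact ⟨e, d, hd, Nat.zero_le _, he, hiff, rfl⟩
    · rintro ⟨e, d, hd, -, he, hiff, rfl⟩
      exact ⟨e, d, hd, he, hiff, fun h2 => absurd h2 hp2, fun h2 => absurd h2 hp2, rfl⟩
  · ext q
    constructor
    · rintro ⟨e, d, hd, he, hiff, h1, -, rfl⟩
      exact ⟨e, d, hd, h1 hp2, he, hiff, rfl⟩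
    · rintro ⟨e, d, hd, h1, he, hiff, rfl⟩
      exact ⟨e, d, hd, he, hiff, fun _ => h1, fun _ h => absurd h h3, rfl⟩
  · ext q
    constructor
    · rintro ⟨e, d, hd, he, hiff, h1, h2, rfl⟩
      exact ⟨e, d, ⟨hd, h2 hp2 h3⟩, h1 hp2, he, hiff, rfl⟩
    · rintro ⟨e, d, ⟨hd, h2⟩, h1, he, hiff, rfl⟩
      exact ⟨e, d, hd, he, hiff, fun _ => h1, fun _ _ => h2, rfl⟩

/-- Since `R(φ)` takes values in `ℕ∞` and the formula is rational, the equality of sets is stated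
in `ℚ`, together with the finiteness of all the Reidemeister numbers. -/
theorem mainTheorem2 {A B C : Type*} [Group A] [Group B] [Group C] (n m p : ℕ)
    (α : C →* MulAut (A × B)) (hG : IsSMC n m p α) (hn : 2 ≤ n) (hm : 1 ≤ m)
    (hm2 : p = 2 → 3 ≤ m)
    (y : C) (hy : Subgroup.zpowers y = ⊤)
    (a : ℕ) (ha : ∀ g : A × B, α y g = g ^ a)
    (β : ℕ) (hβ1 : 1 ≤ β) (hβ2 : β ≤ p - 1)
    (haβ : a ≡ β * p ^ (m - 1) + 1 [MOD p ^ m]) :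
    2 ≤ m ∧
    (∀ r ∈ reidemeisterSpectrum ((A × B) ⋊[α] C), r ≠ ⊤) ∧
    (p ≠ 2 →
      (fun r : ℕ∞ => (r.toNat : ℚ)) '' reidemeisterSpectrum ((A × B) ⋊[α] C) =
        candidateSet m p 0 (divisorTuples (n * p) p)) ∧
    (p = 2 → ¬ 3 ∣ n →
      (fun r : ℕ∞ => (r.toNat : ℚ)) '' reidemeisterSpectrum ((A × B) ⋊[α] C) =
        candidateSet m p 1 (divisorTuples (n * p) p)) ∧
    (p = 2 → 3 ∣ n →
      (fun r : ℕ∞ => (r.toNat : ℚ)) '' reidemeisterSpectrum ((A × B) ⋊[α] C) =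
        candidateSet m p 1 (divisorTuplesThree (n * p) p)) :=
  -- The commutative structures on A and B extend the given group structures, so α and `hG` need no
  -- transport.
  @reidemeisterSpectrum_of_comm A B C (@IsCyclic.commGroup A _ hG.cyclic_A)
    (@IsCyclic.commGroup B _ hG.cyclic_B) _ n m p α hG hn hm hm2 y hy a ha β hβ1 hβ2 haβ
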